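/- Let $X$ be a standard Borel space with a Borel measure $\mu$. Call an equivalence relation $F$ on $X$ finite Borel if $F$ is a Borel subset of $X\times X$ and every $F$-class is finite. Let $E$ be a hyperfinite equivalence relation on $X$, i.e. $E=\bigcup_n E_n$ for some increasing sequence $(E_n)_{n\in\mathbb N}$ of finite Borel equivalence relations on $X$; any such sequence is called a witness to the hyperfiniteness of $E$. Suppose that $E$ is $\mu$-preserving, i.e. $\mu(\varphi(A))=\mu(A)$ for every Borel set $A\subseteq X$ and every injective Borel map $\varphi:A\to X$ such that $(x,\varphi(x))\in E$ for all $x\in A$. Let $w:X\to[0,\infty)$ be a Borel function with $w\in L^1(X,\mu)$, and let $\mu_w$ be the measure given by $d\mu_w=w\,d\mu$. For $f:X\to\mathbb R$ and a finite Borel equivalence relation $F$ put $$A^w_f[F](x)=\frac{\sum_{y\in[x]_F}f(y)\,w(y)}{\sum_{y\in[x]_F}w(y)}$$ if the denominator is nonzero, and $A^w_f[F](x)=0$ otherwise. Theorem (Pointwise ergodic theorem for hyperfinite equivalence relations). For every $f\in L^1(X,\mu_w)$ and every witness $(E_n)_n$ to the hyperfiniteness of $E$, the limit $$A^w_f[E](x)=\lim_{n\to\infty}A^w_f[E_n](x)$$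 exists in $\mathbb R$ for $\mu$-a.e. $x\in X$, and it does not depend on the witness modulo $\mu$-null sets: for any two witnesses the corresponding limits are equal $\mu$-a.e. Furthermore, $A^w_f[E]\in L^1(X,\mu_w)$ and (a) $\int_Y A^w_f[E]\,d\mu_w=\int_Y f\,d\mu_w$ for every $E$-invariant Borel set $Y\subseteq X$; (b) $\|A^w_f[E]\|_{L^1(\mu_w)}\le\|f\|_{L^1(\mu_w)}$. -/

import Mathlib

open MeasureTheory Filter Topology

noncomputable section

namespace HyperfiniteMeans

variable {X : Type*} [MeasurableSpace X]

/-- A finite Borel equivalence relation: its graph is a Borel subset of `X × X` and all of its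
classes are finite. -/
structure IsFiniteBorel (F : Setoid X) : Prop where
  measurableSet_graph : MeasurableSet {p : X × X | F p.1 p.2}
  finite_class : ∀ x, {y | F x y}.Finite

/-- `(E n)` witnesses the hyperfiniteness of `E`: it is an increasing sequence of finite Borel
equivalence relations whose union is `E`. -/
structure IsHyperfiniteWitness (E : Setoid X) (En : ℕ → Setoid X) : Prop where
  isFiniteBorel : ∀ n, IsFiniteBorel (En n)
  monotone : Monotone En
  exhausts : ∀ x y, E x y ↔ ∃ n, En n x y

/-- Hyperfinite (Borel) equivalence relations. -/
def IsHyperfinite (E : Setoid X) : Prop :=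
  ∃ En : ℕ → Setoid X, IsHyperfiniteWitness E En

/-- `E` preserves `μ` (equivalently `μ` is `E`-invariant): every partial Borel injection
`φ : A → X`, with `A` Borel, whose graph is contained in `E` preserves `μ`. The values of `φ`
outside `A` are irrelevant. -/
def PreservesMeasure (E : Setoid X) (μ : Measure X) : Prop :=
  ∀ (A : Set X) (φ : X → X), MeasurableSet A → Measurable φ → Set.InjOn φ A →
    (∀ x ∈ A, E x (φ x)) → μ (φ '' A) = μ A

/-- The set `Y` is a union of `E`-classes. -/
def IsInvariant (E : Setoid X) (Y : Set X) : Prop :=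
  ∀ x y, E x y → x ∈ Y → y ∈ Y

/-- The `w`-weight `∑ y ∈ U, w y` of a finite set `U`. -/
def weightOf (w : X → ℝ) (U : Set X) : ℝ := ∑ᶠ y ∈ U, w y

open Classical in
/-- The `w`-weighted mean of `f` over a finite set `U`. -/
def setMean (w f : X → ℝ) (U : Set X) : ℝ :=
  if weightOf w U ≠ 0 then (∑ᶠ y ∈ U, f y * w y) / weightOf w U else 0

/-- The `w`-weighted mean of `f` over a finite equivalence relation `F`: the function that sends
`x` to the mean of `f` over the `F`-class of `x`. -/
def relMean (w f : X → ℝ) (F : Setoid X) (x : X) : ℝ := setMean w f {y | F x y}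

/-- The measure `μ_w` given by `dμ_w = w dμ`. -/
def weightedMeasure (μ : Measure X) (w : X → ℝ) : Measure X :=
  μ.withDensity fun x => ENNReal.ofReal (w x)

end HyperfiniteMeans

end

/-!
Mass transport along finite Borel subrelations `F` of `E` shows that averaging over `F`-classes with
weights `w` is a kernel reversible for `μ_w`, and it fixes the `F`-invariant functions, so `f` is
sent to its conditional expectation given the `F`-invariant Borel sets. For a witness `(E n)`, the
σ-algebras of `E n`-invariant Borel sets decrease to that of `E`-invariant Borel sets, and Lévy's
downward theorem gives convergence `μ_w`-almost everywhere to a limit which does not mention the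
witness. As `E` preserves `μ`, null sets have null saturation, and convergence at one point of
positive weight forces convergence on its whole class, hence `μ`-almost everywhere on the classes
that carry weight; on the others all means vanish.

Mass transport requires `F` to be a countable union of graphs of partial Borel injections, that is,
the Lusin–Novikov theorem for the graph of `F`. It is derived from Novikov's separation theorem for
sequences of analytic sets.
-/

noncomputable section

namespace HyperfiniteMeans

section Novikov

variable {α ι : Type*} [MeasurableSpace α]

/-- The analogue of `MeasurablySeparable` for a family of sets: the members of the family can be
enlarged to measurable sets with empty intersection. -/
def JointlyMeasurablySeparable (A : ι → Set α) : Prop :=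
  ∃ B : ι → Set α, (∀ i, A i ⊆ B i) ∧ (∀ i, MeasurableSet (B i)) ∧ ⋂ i, B i = ∅

theorem JointlyMeasurablySeparable.of_measurablySeparable {A : ι → Set α} {i j : ι} (hij : i ≠ j)
    (h : MeasurablySeparable (A i) (A j)) : JointlyMeasurablySeparable A := by
  classical
  obtain ⟨u, hiu, hju, hu⟩ := h
  refine ⟨Function.update (Function.update (fun _ => Set.univ) i u) j uᶜ, fun k => ?_, fun k => ?_,
    ?_⟩
  · rcases eq_or_ne k j with rfl | hkj
    · simpa using hju.subset_compl_right
    · rcases eq_or_ne k i with rfl | hki <;> simp [*]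
  · rcases eq_or_ne k j with rfl | hkj
    · simpa using hu
    · rcases eq_or_ne k i with rfl | hki <;> simp [*]
  · refine Set.eq_empty_of_forall_notMem fun x hx => ?_
    have hxi := Set.mem_iInter.1 hx i
    have hxj := Set.mem_iInter.1 hx j
    rw [Function.update_of_ne hij, Function.update_self] at hxi
    rw [Function.update_self] at hxj
    exact hxj hxi

theorem JointlyMeasurablySeparable.of_subset_iUnion {κ : Type*} [Countable κ] {A : ι → Set α}
    {A' : κ → ι → Set α} {i : ι} (hi : A i ⊆ ⋃ v, A' v i) (hne : ∀ v, ∀ j ≠ i, A j ⊆ A' v j)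
    (h : ∀ v, JointlyMeasurablySeparable (A' v)) : JointlyMeasurablySeparable A := by
  classical
  choose B hAB hB hempty using h
  refine ⟨Function.update (fun j => ⋂ v, B v j) i (⋃ v, B v i), fun j => ?_, fun j => ?_, ?_⟩
  · rcases eq_or_ne j i with rfl | hj
    · simpa using hi.trans (Set.iUnion_mono fun v => hAB v j)
    · simpa [hj] using fun v => (hne v j hj).trans (hAB v j)
  · rcases eq_or_ne j i with rfl | hj
    · simpa using MeasurableSet.iUnion fun v => hB v j
    · simpa [hj] using MeasurableSet.iInter fun v => hB v j
  · refine Set.eq_empty_of_forall_notMem fun x hx => ?_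
    rw [Set.mem_iInter] at hx
    obtain ⟨v, hv⟩ : ∃ v, x ∈ B v i := by simpa using hx i
    refine Set.notMem_empty x (hempty v ▸ Set.mem_iInter.2 fun j => ?_)
    rcases eq_or_ne j i with rfl | hj
    · exact hv
    · have hxj : ∀ v, x ∈ B v j := by simpa [hj] using hx j
      exact hxj v

theorem exists_forall_cylinder {E : ℕ → Type*} [∀ n, Nonempty (E n)]
    {P : Set (∀ n, E n) → Prop} (h0 : P Set.univ)
    (hstep : ∀ z n, P (PiNat.cylinder z n) →
      ∃ v, P (PiNat.cylinder (Function.update z n v) (n + 1))) :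
    ∃ z, ∀ n, P (PiNat.cylinder z n) := by
  choose! v hv using hstep
  let Z : ℕ → ∀ n, E n := fun t =>
    Nat.rec (Classical.arbitrary _) (fun n z => Function.update z n (v z n)) t
  have hPZ : ∀ n, P (PiNat.cylinder (Z n) n) := by
    intro n
    induction n with
    | zero => simpa using h0
    | succ n ih => exact hv _ _ ih
  have hZ : ∀ n, ∀ i < n, Z n i = Z (i + 1) i := by
    intro n
    induction n with
    | zero => simp
    | succ n ih =>
      intro i hi
      rcases Nat.lt_succ_iff_lt_or_eq.1 hi with hi | rfl
      · exact (Function.update_of_ne hi.ne _ _).trans (ih i hi)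
      · rfl
  refine ⟨fun n => Z (n + 1) n, fun n => ?_⟩
  rw [PiNat.mem_cylinder_iff_eq.1 fun i hi => (hZ n i hi).symm]
  exact hPZ n

theorem image_cylinder_subset_of_forall_update {E : ℕ → Type*} {β : Type*} {g : (∀ n, E n) → β}
    {t : ℕ} (hg : ∀ u v, g (Function.update u t v) = g u) (z : ∀ n, E n) (v : E t) :
    g '' PiNat.cylinder z t ⊆ g '' PiNat.cylinder (Function.update z t v) (t + 1) := by
  rintro _ ⟨u, hu, rfl⟩
  refine ⟨Function.update u t v, fun i hi => ?_, hg u v⟩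
  rcases Nat.lt_succ_iff_lt_or_eq.1 hi with hi | rfl
  · rw [Function.update_of_ne hi.ne, Function.update_of_ne hi.ne, hu i hi]
  · rw [Function.update_self, Function.update_self]

variable [TopologicalSpace α] [T2Space α] [OpensMeasurableSpace α]

/-- If the ranges were not separable, some branch of `ℕ → ℕ` would have non-separable images of all
its cylinders: refining a cylinder by its next coordinate changes at most one of the images. By
continuity, all `g i` would agree at that branch. -/
theorem jointlyMeasurablySeparable_range {g : ι → (ℕ → ℕ) → α} (hg : ∀ i, Continuous (g i))
    (hdep : ∀ t, ∃ i, ∀ j ≠ i, ∀ u v, g j (Function.update u t v) = g j u)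
    (hempty : ⋂ i, Set.range (g i) = ∅) :
    JointlyMeasurablySeparable fun i => Set.range (g i) := by
  by_contra hsep
  obtain ⟨z, hz⟩ : ∃ z, ∀ n, ¬ JointlyMeasurablySeparable fun i => g i '' PiNat.cylinder z n := by
    refine exists_forall_cylinder (P := fun C => ¬ JointlyMeasurablySeparable fun i => g i '' C)
      (by simpa only [Set.image_univ] using hsep) fun z t hzt => ?_
    contrapose! hzt
    obtain ⟨i, hi⟩ := hdep t
    refine .of_subset_iUnion (i := i) ?_ (fun v j hj =>
      image_cylinder_subset_of_forall_update (hi j hj) z v) hzt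
    rw [← Set.image_iUnion, PiNat.iUnion_cylinder_update z t]
  obtain ⟨i, j, hij⟩ : ∃ i j, g i z ≠ g j z := by
    by_contra! hall
    rcases isEmpty_or_nonempty ι with hι | ⟨⟨i⟩⟩
    · exact hsep ⟨_, fun i => Set.Subset.rfl, hι.elim, hempty⟩
    · exact Set.notMem_empty (g i z) (hempty ▸ Set.mem_iInter.2 fun j => ⟨z, hall j i⟩)
  obtain ⟨U, V, hU, hV, hiU, hjV, hUV⟩ := t2_separation hij
  obtain ⟨_, ⟨x, n, rfl⟩, hzx, hxW⟩ :=
    (PiNat.isTopologicalBasis_cylinders fun _ => ℕ).exists_subset_of_mem_open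
      (show z ∈ g i ⁻¹' U ∩ g j ⁻¹' V from ⟨hiU, hjV⟩)
      ((hU.preimage (hg i)).inter (hV.preimage (hg j)))
  rw [← PiNat.mem_cylinder_iff_eq.1 hzx] at hxW
  exact hz n <| .of_measurablySeparable (ne_of_apply_ne (g · z) hij)
    ⟨U, Set.image_subset_iff.2 fun u hu => (hxW hu).1,
      hUV.symm.mono_left (Set.image_subset_iff.2 fun u hu => (hxW hu).2), hU.measurableSet⟩

/-- **Novikov's separation theorem**. -/
theorem jointlyMeasurablySeparable_of_analyticSet {A : ℕ → Set α} (hA : ∀ n, AnalyticSet (A n))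
    (hempty : ⋂ n, A n = ∅) : JointlyMeasurablySeparable A := by
  by_cases hA0 : ∃ n, A n = ∅
  · obtain ⟨n, hn⟩ := hA0
    exact .of_measurablySeparable n.succ_ne_self.symm ⟨∅, hn.subset, by simp, .empty⟩
  push Not at hA0
  choose f hf hfA using fun n => ((AnalyticSet_def (A n)).mp (hA n)).resolve_left (hA0 n).ne_empty
  let g : ℕ → (ℕ → ℕ) → α := fun n u => f n fun k => u (Nat.pair n k)
  have hgA : ∀ n, Set.range (g n) = A n := by
    intro n
    refine hfA n ▸ (Set.range_comp_subset_range _ (f n)).antisymm ?_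
    rintro _ ⟨u, rfl⟩
    exact ⟨fun k => u k.unpair.2, by simp⟩
  have hdep : ∀ t, ∃ i, ∀ j ≠ i, ∀ u v, g j (Function.update u t v) = g j u := by
    refine fun t => ⟨t.unpair.1, fun j hj u v => congrArg (f j) (funext fun k => ?_)⟩
    refine Function.update_of_ne (fun h => hj ?_) _ _
    rw [← h, Nat.unpair_pair]
  have hgc : ∀ n, Continuous (g n) := fun n =>
    (hf n).comp (continuous_pi fun k => continuous_apply _)
  have hgempty : ⋂ n, Set.range (g n) = ∅ := by simpa only [hgA] using hempty
  simpa only [hgA] using jointlyMeasurablySeparable_range hgc hdep hgempty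

end Novikov

section LusinNovikov

variable {X Y : Type*} {B : Set (X × Y)}

/-- The points of `B` that are alone in `U` on their vertical section. The members of `B` that
a fixed `U` isolates form the graph of a partial function. -/
def sectionIsolated (B : Set (X × Y)) (U : Set Y) : Set (X × Y) :=
  {p | p ∈ B ∧ p.2 ∈ U ∧ ∀ y ∈ U, (p.1, y) ∈ B → y = p.2}

theorem injOn_fst_sectionIsolated (B : Set (X × Y)) (U : Set Y) :
    Set.InjOn Prod.fst (sectionIsolated B U) := by
  rintro ⟨x, y⟩ ⟨-, -, hy⟩ ⟨x', y'⟩ ⟨hB, hU, -⟩ rfl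
  rw [hy y' hU hB]

theorem iUnion_sectionIsolated_of_finite [TopologicalSpace Y] [T1Space Y] {κ : Type*}
    {U : κ → Set Y} (hU : TopologicalSpace.IsTopologicalBasis (Set.range U))
    (hfin : ∀ x, {y | (x, y) ∈ B}.Finite) : ⋃ n, sectionIsolated B (U n) = B := by
  refine (Set.iUnion_subset fun n p hp => hp.1).antisymm fun ⟨x, y⟩ hp => ?_
  have hopen : IsOpen ({y' | (x, y') ∈ B} \ {y})ᶜ :=
    ((hfin x).subset Set.sdiff_subset).isClosed.isOpen_compl
  obtain ⟨_, ⟨n, rfl⟩, hyU, hUy⟩ := hU.exists_subset_of_mem_open (a := y) (by simp) hopen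
  refine Set.mem_iUnion.2 ⟨n, hp, hyU, fun y' hy'U hy'B => ?_⟩
  by_contra hne
  exact hUy hy'U ⟨hy'B, hne⟩

variable [MeasurableSpace X] [StandardBorelSpace X] [MeasurableSpace Y] [StandardBorelSpace Y]

theorem analyticSet_sdiff_sectionIsolated [TopologicalSpace (X × Y)] [OpensMeasurableSpace (X × Y)]
    [SecondCountableTopology (X × Y)] {U : Set Y} (hB : MeasurableSet B) (hU : MeasurableSet U) :
    AnalyticSet (B \ sectionIsolated B U) := by
  have hm : MeasurableSet {q : (X × Y) × Y | q.1 ∈ B ∧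
      (q.1.2 ∈ U → q.2 ∈ U ∧ (q.1.1, q.2) ∈ B ∧ q.2 ≠ q.1.2)} := by
    refine (measurable_fst hB).inter (.himp (measurable_fst.snd hU) ?_)
    refine (measurable_snd hU).inter (.inter (measurable_fst.fst.prodMk measurable_snd hB) ?_)
    exact (measurableSet_eq_fun measurable_snd measurable_fst.snd).compl
  convert hm.analyticSet_image measurable_fst using 1
  ext p
  constructor
  · rintro ⟨hp, hpU⟩
    simp only [sectionIsolated, Set.mem_ofPred_eq, not_and, not_forall] at hpU
    by_cases hU : p.2 ∈ U
    · obtain ⟨y, hyU, hyB, hne⟩ := hpU hp hU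
      exact ⟨(p, y), ⟨hp, fun _ => ⟨hyU, hyB, hne⟩⟩, rfl⟩
    · exact ⟨(p, p.2), ⟨hp, fun h => absurd h hU⟩, rfl⟩
  · rintro ⟨q, ⟨hp, hq⟩, rfl⟩
    refine ⟨hp, fun ⟨_, hU, hy⟩ => ?_⟩
    obtain ⟨hyU, hyB, hne⟩ := hq hU
    exact hne (hy _ hyU hyB)

/-- The **Lusin–Novikov uniformization theorem** for sets with finite sections. -/
theorem exists_measurableSet_injOn_fst_iUnion_eq (hB : MeasurableSet B)
    (hfin : ∀ x, {y | (x, y) ∈ B}.Finite) :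
    ∃ G : ℕ → Set (X × Y), (∀ k, MeasurableSet (G k)) ∧ (∀ k, Set.InjOn Prod.fst (G k)) ∧
      ⋃ k, G k = B := by
  let := upgradeStandardBorel X
  let := upgradeStandardBorel Y
  obtain ⟨b, hbc, -, hb⟩ := TopologicalSpace.exists_countable_basis Y
  obtain ⟨U, hUb⟩ := (hbc.insert ∅).exists_eq_range (Set.insert_nonempty _ _)
  have hU : TopologicalSpace.IsTopologicalBasis (Set.range U) := hUb ▸ hb.insert_empty
  have hempty : ⋂ n, B \ sectionIsolated B (U n) = ∅ := by
    rw [← Set.sdiff_iUnion, iUnion_sectionIsolated_of_finite hU hfin, Set.sdiff_self]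
  obtain ⟨C, hC, hCm, hCe⟩ := jointlyMeasurablySeparable_of_analyticSet
    (fun n => analyticSet_sdiff_sectionIsolated hB (hU.isOpen (Set.mem_range_self n)).measurableSet)
    hempty
  refine ⟨fun n => B \ C n, fun n => hB.diff (hCm n), fun n => ?_, ?_⟩
  · exact (injOn_fst_sectionIsolated B (U n)).mono fun p hp =>
      by_contra fun h => hp.2 (hC n ⟨hp.1, h⟩)
  · rw [← Set.sdiff_iInter, hCe, Set.sdiff_empty]

end LusinNovikov

section InjectivePartition

variable {X : Type*} [MeasurableSpace X] {F : Setoid X} {G : ℕ → Set (X × X)}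

/-- The graph of `F` is the disjoint union of the measurable sets `G k`, each of which is the graph
of a partial injection. -/
structure IsInjectivePartition (F : Setoid X) (G : ℕ → Set (X × X)) : Prop where
  measurableSet : ∀ k, MeasurableSet (G k)
  injOn_fst : ∀ k, Set.InjOn Prod.fst (G k)
  injOn_snd : ∀ k, Set.InjOn Prod.snd (G k)
  disjoint : Pairwise (Function.onFun Disjoint G)
  iUnion_eq : ⋃ k, G k = {p | F p.1 p.2}

theorem IsInjectivePartition.preimage_swap (hG : IsInjectivePartition F G) :
    IsInjectivePartition F fun k => Prod.swap ⁻¹' G k where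
  measurableSet k := measurable_swap (hG.measurableSet k)
  injOn_fst k _ hp _ hq hpq := Prod.swap_injective (hG.injOn_snd k hp hq hpq)
  injOn_snd k _ hp _ hq hpq := Prod.swap_injective (hG.injOn_fst k hp hq hpq)
  disjoint _ _ hij := (hG.disjoint hij).preimage Prod.swap
  iUnion_eq := by
    rw [← Set.preimage_iUnion, hG.iUnion_eq]
    exact Set.ext fun p => F.comm'

theorem IsFiniteBorel.exists_isInjectivePartition [StandardBorelSpace X] (hF : IsFiniteBorel F) :
    ∃ G, IsInjectivePartition F G := by
  obtain ⟨G, hGm, hGi, hGu⟩ := exists_measurableSet_injOn_fst_iUnion_eq hF.measurableSet_graph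
    hF.finite_class
  let K : ℕ → Set (X × X) := fun k => G k.unpair.1 ∩ Prod.swap ⁻¹' G k.unpair.2
  have hKm : ∀ k, MeasurableSet (K k) := fun k => (hGm _).inter (measurable_swap (hGm _))
  have hsub : ∀ k, disjointed K k ⊆ K k := disjointed_subset K
  refine ⟨disjointed K, fun k => .disjointed hKm k, fun k => ?_, fun k => ?_,
    disjoint_disjointed K, ?_⟩
  · exact (hGi _).mono ((hsub k).trans Set.inter_subset_left)
  · exact fun p hp q hq hpq => Prod.swap_injective (hGi _ (hsub k hp).2 (hsub k hq).2 hpq)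
  · have hmem : ∀ p : X × X, F p.1 p.2 ↔ ∃ k, p ∈ G k := fun p => by
      rw [← Set.mem_iUnion, hGu]
      rfl
    rw [iUnion_disjointed]
    ext p
    constructor
    · intro hp
      obtain ⟨k, hk⟩ := Set.mem_iUnion.1 hp
      exact (hmem p).2 ⟨_, hk.1⟩
    · intro hp
      obtain ⟨i, hi⟩ := (hmem p).1 hp
      obtain ⟨j, hj⟩ := (hmem p.swap).1 (F.symm hp)
      refine Set.mem_iUnion.2 ⟨Nat.pair i j, ?_⟩
      simp only [K, Nat.unpair_pair]
      exact ⟨hi, hj⟩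

end InjectivePartition

section MassTransport

theorem count_section_of_injOn_fst {X Y : Type*} [MeasurableSpace Y] [MeasurableSingletonClass Y]
    {S : Set (X × Y)} (hS : Set.InjOn Prod.fst S) (x : X) :
    Measure.count {y | (x, y) ∈ S} = (Prod.fst '' S).indicator (1 : X → ENNReal) x := by
  have hsub : {y | (x, y) ∈ S}.Subsingleton := fun y hy z hz => congrArg Prod.snd (hS hy hz rfl)
  by_cases hx : x ∈ Prod.fst '' S
  · obtain ⟨⟨x, y⟩, hy, rfl⟩ := hx
    have hsingle : {y' | (x, y') ∈ S} = {y} := hsub.eq_singleton_of_mem hy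
    rw [hsingle, Measure.count_singleton, Set.indicator_of_mem (Set.mem_image_of_mem _ hy),
      Pi.one_apply]
  · have hempty : {y | (x, y) ∈ S} = ∅ :=
      Set.eq_empty_of_forall_notMem fun y hy => hx ⟨(x, y), hy, rfl⟩
    rw [hempty, measure_empty, Set.indicator_of_notMem hx]

theorem setOf_rel_congr {X : Type*} {F : Setoid X} {x y : X} (h : F x y) :
    {z | F x z} = {z | F y z} :=
  Set.ext fun _ => ⟨fun hz => F.trans (F.symm h) hz, fun hz => F.trans h hz⟩

variable {X : Type*} [MeasurableSpace X] {E F : Setoid X} {μ : Measure X}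

/-- The counting measure on the `F`-class of `x`. -/
def classMeasure (F : Setoid X) (x : X) : Measure X := Measure.count.restrict {y | F x y}

theorem classMeasure_congr {x y : X} (h : F x y) : classMeasure F x = classMeasure F y := by
  rw [classMeasure, classMeasure, setOf_rel_congr h]

/-- The counting measure on the part of the graph of `F` above `x`. -/
def graphFiber (F : Setoid X) (x : X) : Measure (X × X) := (classMeasure F x).map (Prod.mk x)

/-- The left counting measure on the graph of `F`: integrating against it means summing over the
`F`-class of `x` and then integrating over `x`. It is defined with `Measure.bind` because
`Measure.compProd` is only meaningful for s-finite `μ`. -/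
def graphMeasure (μ : Measure X) (F : Setoid X) : Measure (X × X) := μ.bind (graphFiber F)

theorem IsFiniteBorel.measurableSet_class (hF : IsFiniteBorel F) (x : X) :
    MeasurableSet {y | F x y} :=
  measurable_prodMk_left hF.measurableSet_graph

theorem IsFiniteBorel.ae_classMeasure_iff [MeasurableSingletonClass X] (hF : IsFiniteBorel F)
    {x : X} {p : X → Prop} : (∀ᵐ y ∂classMeasure F x, p y) ↔ ∀ y, F x y → p y := by
  rw [classMeasure, ae_restrict_iff' (hF.measurableSet_class x), Measure.ae_count_iff]
  rfl

theorem lintegral_graphFiber {c : X × X → ENNReal} (hc : Measurable c) (x : X) :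
    ∫⁻ p, c p ∂graphFiber F x = ∫⁻ y, c (x, y) ∂classMeasure F x :=
  lintegral_map hc measurable_prodMk_left

variable [StandardBorelSpace X]

theorem IsInjectivePartition.graphFiber_apply {G : ℕ → Set (X × X)}
    (hG : IsInjectivePartition F G) {S : Set (X × X)} (hS : MeasurableSet S) (x : X) :
    graphFiber F x S = ∑' k, (Prod.fst '' (S ∩ G k)).indicator (1 : X → ENNReal) x := by
  have hsection : Prod.mk x ⁻¹' S ∩ {y | F x y} = ⋃ k, Prod.mk x ⁻¹' (S ∩ G k) := by
    ext y
    have hxy : F x y ↔ ∃ k, (x, y) ∈ G k := by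
      rw [← Set.mem_iUnion, hG.iUnion_eq]
      rfl
    simp [hxy]
  rw [graphFiber, Measure.map_apply measurable_prodMk_left hS, classMeasure,
    Measure.restrict_apply (measurable_prodMk_left hS), hsection,
    measure_iUnion _ fun k => measurable_prodMk_left (hS.inter (hG.measurableSet k))]
  · exact tsum_congr fun k =>
      count_section_of_injOn_fst ((hG.injOn_fst k).mono Set.inter_subset_right) x
  · exact fun i j hij => ((hG.disjoint hij).mono Set.inter_subset_right
      Set.inter_subset_right).preimage (Prod.mk x)

theorem IsInjectivePartition.measurableSet_image_fst {G : ℕ → Set (X × X)}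
    (hG : IsInjectivePartition F G) {S : Set (X × X)} (hS : MeasurableSet S) (k : ℕ) :
    MeasurableSet (Prod.fst '' (S ∩ G k)) :=
  (hS.inter (hG.measurableSet k)).image_of_measurable_injOn measurable_fst
    ((hG.injOn_fst k).mono Set.inter_subset_right)

theorem IsFiniteBorel.measurable_graphFiber (hF : IsFiniteBorel F) : Measurable (graphFiber F) := by
  obtain ⟨G, hG⟩ := hF.exists_isInjectivePartition
  refine Measure.measurable_of_measurable_coe _ fun S hS => ?_
  simp only [hG.graphFiber_apply hS]
  exact .tsum fun k => measurable_one.indicator (hG.measurableSet_image_fst hS k)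

theorem IsFiniteBorel.measurable_classMeasure (hF : IsFiniteBorel F) :
    Measurable (classMeasure F) := by
  have hmap : classMeasure F = fun x => (graphFiber F x).map Prod.snd := by
    funext x
    rw [graphFiber, Measure.map_map measurable_snd measurable_prodMk_left]
    exact Measure.map_id.symm
  rw [hmap]
  exact (Measure.measurable_map _ measurable_snd).comp hF.measurable_graphFiber

theorem IsInjectivePartition.graphMeasure_apply {G : ℕ → Set (X × X)}
    (hG : IsInjectivePartition F G) (hF : IsFiniteBorel F) (μ : Measure X) {S : Set (X × X)}
    (hS : MeasurableSet S) : graphMeasure μ F S = ∑' k, μ (Prod.fst '' (S ∩ G k)) := by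
  rw [graphMeasure, Measure.bind_apply hS hF.measurable_graphFiber.aemeasurable]
  simp only [hG.graphFiber_apply hS]
  rw [lintegral_tsum fun k =>
    (measurable_one.indicator (hG.measurableSet_image_fst hS k)).aemeasurable]
  exact tsum_congr fun k => lintegral_indicator_one (hG.measurableSet_image_fst hS k)

theorem PreservesMeasure.measure_image_fst_eq (hμ : PreservesMeasure E μ) {G : Set (X × X)}
    (hG : MeasurableSet G) (h1 : Set.InjOn Prod.fst G) (h2 : Set.InjOn Prod.snd G)
    (hE : ∀ p ∈ G, E p.1 p.2) : μ (Prod.fst '' G) = μ (Prod.snd '' G) := by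
  have : StandardBorelSpace G := hG.standardBorel
  have hemb : MeasurableEmbedding fun p : G => p.1.1 :=
    measurable_subtype_coe.fst.measurableEmbedding fun p q hpq => Subtype.ext (h1 p.2 q.2 hpq)
  obtain ⟨φ, hφ, hφG⟩ := hemb.exists_measurable_extend (g := fun p : G => p.1.2)
    measurable_subtype_coe.snd fun x => ⟨x⟩
  have hφ' : ∀ p ∈ G, φ p.1 = p.2 := fun p hp => congrFun hφG ⟨p, hp⟩
  have himage : φ '' (Prod.fst '' G) = Prod.snd '' G := by
    rw [Set.image_image]
    exact Set.image_congr hφ'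
  rw [← himage]
  refine (hμ _ φ (hG.image_of_measurable_injOn measurable_fst h1) hφ ?_ ?_).symm
  · rintro _ ⟨p, hp, rfl⟩ _ ⟨q, hq, rfl⟩ hpq
    rw [hφ' p hp, hφ' q hq] at hpq
    rw [h2 hp hq hpq]
  · rintro _ ⟨p, hp, rfl⟩
    rw [hφ' p hp]
    exact hE p hp

theorem IsFiniteBorel.map_swap_graphMeasure (hF : IsFiniteBorel F) (hμ : PreservesMeasure E μ)
    (hFE : F ≤ E) : (graphMeasure μ F).map Prod.swap = graphMeasure μ F := by
  obtain ⟨G, hG⟩ := hF.exists_isInjectivePartition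
  ext S hS
  rw [Measure.map_apply measurable_swap hS, hG.graphMeasure_apply hF μ hS,
    hG.preimage_swap.graphMeasure_apply hF μ (measurable_swap hS)]
  refine tsum_congr fun k => ?_
  rw [← Set.preimage_inter, ← Set.image_swap_eq_preimage_swap, Set.image_image]
  refine (hμ.measure_image_fst_eq (hS.inter (hG.measurableSet k))
    ((hG.injOn_fst k).mono Set.inter_subset_right)
    ((hG.injOn_snd k).mono Set.inter_subset_right) fun p hp => hFE ?_).symm
  exact hG.iUnion_eq.subset (Set.mem_iUnion.2 ⟨k, hp.2⟩)

theorem IsFiniteBorel.lintegral_graphMeasure (hF : IsFiniteBorel F) (μ : Measure X)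
    {c : X × X → ENNReal} (hc : Measurable c) :
    ∫⁻ p, c p ∂graphMeasure μ F = ∫⁻ x, ∫⁻ y, c (x, y) ∂classMeasure F x ∂μ := by
  rw [graphMeasure, Measure.lintegral_bind hF.measurable_graphFiber.aemeasurable hc.aemeasurable]
  simp only [lintegral_graphFiber hc]

/-- The **mass transport principle**. -/
theorem IsFiniteBorel.lintegral_lintegral_classMeasure_swap (hF : IsFiniteBorel F)
    (hμ : PreservesMeasure E μ) (hFE : F ≤ E) {c : X × X → ENNReal} (hc : Measurable c) :
    ∫⁻ x, ∫⁻ y, c (x, y) ∂classMeasure F x ∂μ = ∫⁻ x, ∫⁻ y, c (y, x) ∂classMeasure F x ∂μ := by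
  calc ∫⁻ x, ∫⁻ y, c (x, y) ∂classMeasure F x ∂μ
      = ∫⁻ p, c p ∂(graphMeasure μ F).map Prod.swap := by
        rw [hF.map_swap_graphMeasure hμ hFE, hF.lintegral_graphMeasure μ hc]
    _ = ∫⁻ p, c p.swap ∂graphMeasure μ F := lintegral_map hc measurable_swap
    _ = ∫⁻ x, ∫⁻ y, c (y, x) ∂classMeasure F x ∂μ :=
        hF.lintegral_graphMeasure μ (hc.comp measurable_swap)

theorem IsFiniteBorel.ae_forall_class (hF : IsFiniteBorel F) (hμ : PreservesMeasure E μ)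
    (hFE : F ≤ E) {p : X → Prop} (hp : ∀ᵐ x ∂μ, p x) : ∀ᵐ x ∂μ, ∀ y, F x y → p y := by
  obtain ⟨N, hpN, hN, hN0⟩ := exists_measurable_superset_of_null (ae_iff.1 hp)
  have htransport : ∫⁻ x, classMeasure F x N ∂μ = 0 := by
    have hc : Measurable fun q : X × X => N.indicator (1 : X → ENNReal) q.2 :=
      (measurable_one.indicator hN).comp measurable_snd
    calc ∫⁻ x, classMeasure F x N ∂μ
        = ∫⁻ x, ∫⁻ y, N.indicator 1 y ∂classMeasure F x ∂μ := by
          simp only [lintegral_indicator_one hN]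
      _ = ∫⁻ x, ∫⁻ _, N.indicator 1 x ∂classMeasure F x ∂μ :=
          hF.lintegral_lintegral_classMeasure_swap hμ hFE hc
      _ = 0 := by
          refine lintegral_eq_zero_of_ae_eq_zero ?_
          filter_upwards [measure_eq_zero_iff_ae_notMem.1 hN0] with x hx
          simp [hx]
  have hclass : Measurable fun x => classMeasure F x N :=
    (Measure.measurable_coe hN).comp hF.measurable_classMeasure
  filter_upwards [(lintegral_eq_zero_iff hclass).1 htransport] with x hx
  have hclassN : ∀ y, F x y → y ∉ N :=
    hF.ae_classMeasure_iff.1 (measure_eq_zero_iff_ae_notMem.1 hx)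
  exact fun y hxy => by_contra fun hy => hclassN y hxy (hpN hy)

end MassTransport

section LevyDownward

theorem tendsto_starProjection_iInf {𝕜 H ι : Type*} [RCLike 𝕜] [NormedAddCommGroup H]
    [InnerProductSpace 𝕜 H] [CompleteSpace H] [Preorder ι] (U : ι → Submodule 𝕜 H)
    [∀ i, (U i).HasOrthogonalProjection] [(⨅ i, U i).HasOrthogonalProjection]
    (hU : Antitone U) (x : H) :
    Tendsto (fun i => (U i).starProjection x) atTop (𝓝 ((⨅ i, U i).starProjection x)) := by
  have hclosure : (⨆ i, (U i)ᗮ).topologicalClosure = (⨅ i, U i)ᗮ := by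
    rw [← Submodule.orthogonal_orthogonal_eq_closure, ← Submodule.iInf_orthogonal]
    simp only [Submodule.orthogonal_orthogonal]
  have : (⨆ i, (U i)ᗮ).topologicalClosure.HasOrthogonalProjection := by
    rw [hclosure]
    infer_instance
  have horth := Submodule.starProjection_tendsto_closure_iSup (fun i => (U i)ᗮ)
    (fun i j hij => Submodule.orthogonal_le (hU hij)) x
  simp only [hclosure, Submodule.starProjection_orthogonal_val] at horth
  simpa only [sub_sub_cancel] using (tendsto_const_nhds (x := x)).sub horth

theorem ae_tendsto_of_forall_measure_frequently_eq_zero {Ω E : Type*} {_ : MeasurableSpace Ω}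
    {μ : Measure Ω} [PseudoMetricSpace E] {u : ℕ → Ω → E} {g : Ω → E}
    (h : ∀ ε : NNReal, 0 < ε → μ {x | ∃ᶠ n in atTop, (ε : ℝ) ≤ dist (u n x) (g x)} = 0) :
    ∀ᵐ x ∂μ, Tendsto (fun n => u n x) atTop (𝓝 (g x)) := by
  obtain ⟨ε, -, hεpos, hε⟩ := exists_seq_strictAnti_tendsto (0 : NNReal)
  have hev : ∀ᵐ x ∂μ, ∀ k, ¬ ∃ᶠ n in atTop, (ε k : ℝ) ≤ dist (u n x) (g x) :=
    ae_all_iff.2 fun k => measure_eq_zero_iff_ae_notMem.1 (h (ε k) (hεpos k))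
  filter_upwards [hev] with x hx
  refine Metric.tendsto_nhds.2 fun δ hδ => ?_
  obtain ⟨k, hk⟩ := (hε.eventually (gt_mem_nhds (show 0 < δ.toNNReal by simpa using hδ))).exists
  filter_upwards [not_frequently.1 (hx k)] with n hn
  exact (not_le.1 hn).trans (Real.lt_toNNReal_iff_coe_lt.1 hk)

theorem lpMeas_mono (𝕜 F : Type*) [RCLike 𝕜] [NormedAddCommGroup F] [NormedSpace 𝕜 F]
    (p : ENNReal) {Ω : Type*} {m₁ m₂ m0 : MeasurableSpace Ω} {μ : Measure Ω} (h : m₁ ≤ m₂) :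
    lpMeas F 𝕜 m₁ p μ ≤ lpMeas F 𝕜 m₂ p μ := by
  intro f hf
  rw [mem_lpMeas_iff_aestronglyMeasurable] at hf ⊢
  exact hf.mono h

variable {Ω : Type*} {m0 : MeasurableSpace Ω} {μ : Measure Ω} {m : ℕ → MeasurableSpace Ω}

theorem stronglyMeasurable_iInf {β : Type*} [TopologicalSpace β]
    [TopologicalSpace.PseudoMetrizableSpace β] {ι : Type*} [Nonempty ι]
    {m : ι → MeasurableSpace Ω} {f : Ω → β} (hf : ∀ i, StronglyMeasurable[m i] f) :
    StronglyMeasurable[⨅ i, m i] f := by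
  borelize β
  refine stronglyMeasurable_iff_measurable_separable.2 ⟨fun s hs => ?_, ?_⟩
  · exact MeasurableSpace.measurableSet_iInf.2 fun i => (hf i).measurable hs
  · exact (hf (Classical.arbitrary ι)).isSeparable_range

theorem aestronglyMeasurable_iInf {β : Type*} [TopologicalSpace β]
    [TopologicalSpace.IsCompletelyMetrizableSpace β] [Nonempty β] (hm : Antitone m) {f : Ω → β}
    (hf : ∀ n, AEStronglyMeasurable[m n] f μ) : AEStronglyMeasurable[⨅ n, m n] f μ := by
  choose g hg hfg using hf
  refine ⟨fun x => limUnder atTop fun n => g n x, stronglyMeasurable_iInf fun N => ?_, ?_⟩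
  · have htail : (fun x => limUnder atTop fun n => g n x) =
        fun x => limUnder atTop fun n => g (n + N) x := by
      funext x
      conv_lhs => rw [limUnder, ← map_add_atTop_eq_nat N, map_map]
      rfl
    rw [htail]
    let _ := m N
    exact .limUnder fun n => (hg (n + N)).mono (hm (Nat.le_add_left N n))
  · filter_upwards [ae_all_iff.2 hfg] with x hx
    simp only [← hx]
    exact tendsto_const_nhds.limUnder_eq.symm

theorem lpMeas_iInf {𝕜 F : Type*} [RCLike 𝕜] [NormedAddCommGroup F] [NormedSpace 𝕜 F]
    [CompleteSpace F] (hm : Antitone m) (p : ENNReal) :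
    lpMeas F 𝕜 (⨅ n, m n) p μ = ⨅ n, lpMeas F 𝕜 (m n) p μ := by
  ext f
  simp only [Submodule.mem_iInf, mem_lpMeas_iff_aestronglyMeasurable]
  exact ⟨fun h n => h.mono (iInf_le m n), aestronglyMeasurable_iInf hm⟩

section Banach

variable {E : Type*} [NormedAddCommGroup E] [NormedSpace ℝ E] [CompleteSpace E]

theorem eLpNorm_condExp_sub_condExp_le {m₁ m₂ : MeasurableSpace Ω}
    {f s : Ω → E} (hf : Integrable f μ) (hs : Integrable s μ) {p : ENNReal} (hp : 1 ≤ p) :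
    eLpNorm (μ[f | m₁] - μ[f | m₂]) p μ ≤
      eLpNorm (f - s) p μ + eLpNorm (μ[s | m₁] - μ[s | m₂]) p μ + eLpNorm (f - s) p μ := by
  have hmeas (g : Ω → E) (m : MeasurableSpace Ω) : AEStronglyMeasurable[m0] (μ[g | m]) μ :=
    integrable_condExp.aestronglyMeasurable
  have hae : μ[f | m₁] - μ[f | m₂] =ᵐ[μ]
      μ[f - s | m₁] + (μ[s | m₁] - μ[s | m₂]) - μ[f - s | m₂] := by
    filter_upwards [condExp_sub hf hs m₁, condExp_sub hf hs m₂] with x h₁ h₂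
    simp only [Pi.sub_apply, Pi.add_apply] at h₁ h₂ ⊢
    rw [h₁, h₂]
    abel
  calc eLpNorm (μ[f | m₁] - μ[f | m₂]) p μ
      = eLpNorm (μ[f - s | m₁] + (μ[s | m₁] - μ[s | m₂]) - μ[f - s | m₂]) p μ :=
        eLpNorm_congr_ae hae
    _ ≤ eLpNorm (μ[f - s | m₁] + (μ[s | m₁] - μ[s | m₂])) p μ + eLpNorm (μ[f - s | m₂]) p μ :=
        eLpNorm_sub_le ((hmeas _ _).add ((hmeas _ _).sub (hmeas _ _))) (hmeas _ _) hp
    _ ≤ eLpNorm (μ[f - s | m₁]) p μ + eLpNorm (μ[s | m₁] - μ[s | m₂]) p μ +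
          eLpNorm (μ[f - s | m₂]) p μ := by
        gcongr
        exact eLpNorm_add_le (hmeas _ _) ((hmeas _ _).sub (hmeas _ _)) hp
    _ ≤ eLpNorm (f - s) p μ + eLpNorm (μ[s | m₁] - μ[s | m₂]) p μ + eLpNorm (f - s) p μ := by
        gcongr <;> exact eLpNorm_condExp_le_eLpNorm _ hp

theorem submartingale_norm_of_martingale {ι : Type*} [Preorder ι] {ℱ : Filtration ι m0}
    {M : ι → Ω → E} (hM : Martingale M ℱ μ) : Submartingale (fun i x => ‖M i x‖) ℱ μ := by
  refine ⟨fun i => (hM.stronglyMeasurable i).norm, fun i j hij => ?_, fun i =>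
    (hM.integrable i).norm⟩
  filter_upwards [hM.condExp_ae_eq hij, norm_condExp_le (μ := μ) (m := ℱ i) (M j)] with x hx hle
  rwa [hx] at hle

theorem mul_measure_exists_index_le_norm_condExp_le [IsFiniteMeasure μ] (hm : Antitone m)
    (hle : ∀ n, m n ≤ m0) (f : Ω → E) (ε : NNReal) (N : ℕ) :
    ε * μ {x | ∃ n ≤ N, (ε : ℝ) ≤ ‖μ[f | m n] x‖} ≤ eLpNorm f 1 μ := by
  let ℱ : Filtration ℕ m0 :=
    ⟨fun k => m (N - k), fun i j hij => hm (Nat.sub_le_sub_left hij N), fun k => hle _⟩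
  have hsub := submartingale_norm_of_martingale (martingale_condExp f ℱ μ)
  calc ε * μ {x | ∃ n ≤ N, (ε : ℝ) ≤ ‖μ[f | m n] x‖}
      ≤ ε * μ {x | (ε : ℝ) ≤ (Finset.range (N + 1)).sup' Finset.nonempty_range_add_one
          fun k => ‖μ[f | ℱ k] x‖} := by
        gcongr with x
        rintro ⟨n, hn, hx⟩
        refine Finset.le_sup'_of_le (fun k => ‖μ[f | ℱ k] x‖) (b := N - n)
          (Finset.mem_range.2 (by omega)) ?_
        change (ε : ℝ) ≤ ‖μ[f | m (N - (N - n))] x‖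
        rwa [Nat.sub_sub_self hn]
    _ ≤ _ := maximal_ineq hsub (fun k x => norm_nonneg _) N
    _ ≤ ENNReal.ofReal (∫ x, ‖μ[f | ℱ N] x‖ ∂μ) :=
        ENNReal.ofReal_le_ofReal (setIntegral_le_integral (hsub.integrable N)
          (Eventually.of_forall fun x => norm_nonneg _))
    _ = eLpNorm (μ[f | ℱ N]) 1 μ := by
        rw [ofReal_integral_norm_eq_lintegral_enorm integrable_condExp,
          eLpNorm_one_eq_lintegral_enorm]
    _ ≤ eLpNorm f 1 μ := eLpNorm_condExp_le_eLpNorm f le_rfl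

theorem mul_measure_exists_le_norm_condExp_le [IsFiniteMeasure μ] (hm : Antitone m)
    (hle : ∀ n, m n ≤ m0) (f : Ω → E) (ε : NNReal) :
    ε * μ {x | ∃ n, (ε : ℝ) ≤ ‖μ[f | m n] x‖} ≤ eLpNorm f 1 μ := by
  have hunion : {x | ∃ n, (ε : ℝ) ≤ ‖μ[f | m n] x‖} =
      ⋃ N : ℕ, {x | ∃ n ≤ N, (ε : ℝ) ≤ ‖μ[f | m n] x‖} := by
    ext x
    simp only [Set.mem_ofPred_eq, Set.mem_iUnion]
    exact ⟨fun ⟨n, hn⟩ => ⟨n, n, le_rfl, hn⟩, fun ⟨_, n, _, hn⟩ => ⟨n, hn⟩⟩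
  have hmono : Monotone fun N : ℕ => {x | ∃ n ≤ N, (ε : ℝ) ≤ ‖μ[f | m n] x‖} :=
    fun N N' hN x ⟨n, hn, hx⟩ => ⟨n, hn.trans hN, hx⟩
  rw [hunion, hmono.measure_iUnion, ENNReal.mul_iSup]
  exact iSup_le (mul_measure_exists_index_le_norm_condExp_le hm hle f ε)

theorem condExp_condExp_sub_condExp_of_le {m₁ m₂ m₃ : MeasurableSpace Ω} (h₁₂ : m₁ ≤ m₂)
    (h₂₃ : m₂ ≤ m₃) (h₃ : m₃ ≤ m0) [SigmaFinite (μ.trim h₃)] [SigmaFinite (μ.trim (h₂₃.trans h₃))]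
    (f : Ω → E) : μ[μ[f | m₃] - μ[f | m₁] | m₂] =ᵐ[μ] μ[f | m₂] - μ[f | m₁] := by
  have htower : μ[μ[f | m₃] | m₂] =ᵐ[μ] μ[f | m₂] := condExp_condExp_of_le h₂₃ h₃
  have hfixed : μ[μ[f | m₁] | m₂] = μ[f | m₁] := condExp_of_stronglyMeasurable (h₂₃.trans h₃)
    (stronglyMeasurable_condExp.mono h₁₂) integrable_condExp
  have hsub := condExp_sub (μ := μ) (integrable_condExp (f := f) (m := m₃))
    (integrable_condExp (f := f) (m := m₁)) m₂
  rw [hfixed] at hsub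
  exact hsub.trans (htower.sub EventuallyEq.rfl)

theorem mul_measure_frequently_le_norm_condExp_sub_le [IsFiniteMeasure μ] (hm : Antitone m)
    (hle : ∀ n, m n ≤ m0) (f : Ω → E) (ε : NNReal) (N : ℕ) :
    ε * μ {x | ∃ᶠ n in atTop, (ε : ℝ) ≤ dist (μ[f | m n] x) (μ[f | ⨅ n, m n] x)} ≤
      eLpNorm (μ[f | m N] - μ[f | ⨅ n, m n]) 1 μ := by
  have htail : ∀ᵐ x ∂μ, ∀ n, μ[μ[f | m N] - μ[f | ⨅ n, m n] | m (n + N)] x =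
      (μ[f | m (n + N)] - μ[f | ⨅ n, m n]) x :=
    ae_all_iff.2 fun n => condExp_condExp_sub_condExp_of_le (iInf_le m _)
      (hm (Nat.le_add_left N n)) (hle N) f
  refine le_trans ?_ (mul_measure_exists_le_norm_condExp_le (m := fun n => m (n + N))
    (fun i j hij => hm (Nat.add_le_add_right hij N)) (fun n => hle _) _ ε)
  refine mul_le_mul_right (measure_mono_ae ?_) _
  filter_upwards [htail] with x hx hfreq
  obtain ⟨n, hn, hnx⟩ := frequently_atTop.1 hfreq N
  refine ⟨n - N, ?_⟩
  rwa [hx, Nat.sub_add_cancel hn, Pi.sub_apply, ← dist_eq_norm]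

end Banach

variable {E : Type*} [NormedAddCommGroup E] [InnerProductSpace ℝ E] [CompleteSpace E]
  [IsFiniteMeasure μ]

theorem tendsto_eLpNorm_two_condExp_iInf (hm : Antitone m) (hle : ∀ n, m n ≤ m0) {f : Ω → E}
    (hf : MemLp f 2 μ) :
    Tendsto (fun n => eLpNorm (μ[f | m n] - μ[f | ⨅ n, m n]) 2 μ) atTop (𝓝 0) := by
  have hi : ⨅ n, m n ≤ m0 := (iInf_le m 0).trans (hle 0)
  have (n : ℕ) : Fact (m n ≤ m0) := ⟨hle n⟩
  have : Fact (⨅ n, m n ≤ m0) := ⟨hi⟩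
  have hinf := lpMeas_iInf (𝕜 := ℝ) (F := E) (μ := μ) hm 2
  have : (⨅ n, lpMeas E ℝ (m n) 2 μ).HasOrthogonalProjection := by
    rw [← hinf]
    infer_instance
  have hproj := tendsto_starProjection_iInf (fun n => lpMeas E ℝ (m n) 2 μ)
    (fun i j hij => lpMeas_mono ℝ E 2 (hm hij)) hf.toLp
  simp only [← hinf] at hproj
  rw [Lp.tendsto_Lp_iff_tendsto_eLpNorm'] at hproj
  refine hproj.congr fun n => eLpNorm_congr_ae ?_
  exact (hf.condExpL2_ae_eq_condExp (𝕜 := ℝ) (hle n)).sub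
    (hf.condExpL2_ae_eq_condExp (𝕜 := ℝ) hi)

theorem tendsto_eLpNorm_one_condExp_iInf_of_memLp_two (hm : Antitone m) (hle : ∀ n, m n ≤ m0)
    {f : Ω → E} (hf : MemLp f 2 μ) :
    Tendsto (fun n => eLpNorm (μ[f | m n] - μ[f | ⨅ n, m n]) 1 μ) atTop (𝓝 0) := by
  have hbound := ENNReal.Tendsto.mul_const
    (b := μ Set.univ ^ (1 / (1 : ENNReal).toReal - 1 / (2 : ENNReal).toReal))
    (tendsto_eLpNorm_two_condExp_iInf hm hle hf)
    (Or.inr (ENNReal.rpow_ne_top_of_nonneg (by norm_num) (measure_ne_top μ _)))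
  rw [zero_mul] at hbound
  refine tendsto_of_tendsto_of_tendsto_of_le_of_le tendsto_const_nhds hbound
    (fun _ => zero_le) fun n => eLpNorm_le_eLpNorm_mul_rpow_measure_univ one_le_two ?_
  exact integrable_condExp.aestronglyMeasurable.sub integrable_condExp.aestronglyMeasurable

theorem tendsto_eLpNorm_one_condExp_iInf (hm : Antitone m) (hle : ∀ n, m n ≤ m0) {f : Ω → E}
    (hf : Integrable f μ) :
    Tendsto (fun n => eLpNorm (μ[f | m n] - μ[f | ⨅ n, m n]) 1 μ) atTop (𝓝 0) := by
  refine ENNReal.tendsto_nhds_zero.2 fun ε hε => ?_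
  have hε3 : ε / 3 ≠ 0 := (ENNReal.div_pos hε.ne' (by simp)).ne'
  obtain ⟨s, hfs, hs⟩ : ∃ s : Ω → E, eLpNorm (f - s) 1 μ < ε / 3 ∧ MemLp s 2 μ := by
    obtain ⟨s, hfs, -⟩ := (memLp_one_iff_integrable.2 hf).exists_simpleFunc_eLpNorm_sub_lt
      ENNReal.one_ne_top hε3
    exact ⟨s, hfs, s.memLp_of_isFiniteMeasure 2 μ⟩
  filter_upwards [ENNReal.tendsto_nhds_zero.1
    (tendsto_eLpNorm_one_condExp_iInf_of_memLp_two hm hle hs) (ε / 3)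
    (pos_iff_ne_zero.2 hε3)] with n hn
  calc eLpNorm (μ[f | m n] - μ[f | ⨅ n, m n]) 1 μ
      ≤ eLpNorm (f - s) 1 μ + eLpNorm (μ[s | m n] - μ[s | ⨅ n, m n]) 1 μ +
          eLpNorm (f - s) 1 μ :=
        eLpNorm_condExp_sub_condExp_le hf (hs.integrable one_le_two) le_rfl
    _ ≤ ε / 3 + ε / 3 + ε / 3 := by gcongr
    _ = ε := ENNReal.add_thirds ε

/-- **Lévy's downward theorem**. -/
theorem ae_tendsto_condExp_iInf (hm : Antitone m) (hle : ∀ n, m n ≤ m0) {f : Ω → E}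
    (hf : Integrable f μ) :
    ∀ᵐ x ∂μ, Tendsto (fun n => μ[f | m n] x) atTop (𝓝 (μ[f | ⨅ n, m n] x)) := by
  refine ae_tendsto_of_forall_measure_frequently_eq_zero fun ε hε => ?_
  have hzero := ge_of_tendsto' (tendsto_eLpNorm_one_condExp_iInf hm hle hf)
    (mul_measure_frequently_le_norm_condExp_sub_le hm hle f ε)
  simpa [hε.ne'] using hzero

end LevyDownward

section KernelCondExp

open ProbabilityTheory

variable {Ω : Type*} {m m0 : MeasurableSpace Ω} {κ : @Kernel Ω Ω m0 m0} {ν : Measure[m0] Ω}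

theorem bind_restrict_of_isReversible (hκ : κ.IsReversible ν) {Y : Set Ω}
    (hY : MeasurableSet[m0] Y) (hκY : (κ · Y) =ᵐ[ν] Y.indicator 1) :
    (ν.restrict Y).bind κ = ν.restrict Y := by
  ext A hA
  calc (ν.restrict Y).bind κ A
      = ∫⁻ x in Y, κ x A ∂ν := Measure.bind_apply hA κ.measurable.aemeasurable
    _ = ∫⁻ x in A, κ x Y ∂ν := hκ hY hA
    _ = ∫⁻ x in A, Y.indicator 1 x ∂ν := lintegral_congr_ae (ae_restrict_of_ae hκY)
    _ = ν.restrict Y A := by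
      rw [lintegral_indicator_one hY, Measure.restrict_apply hY, Measure.restrict_apply hA,
        Set.inter_comm]

variable {E : Type*} [NormedAddCommGroup E] [NormedSpace ℝ E]

theorem integrable_integral_bind {f : Ω → E} (hf : Integrable f (ν.bind κ)) :
    Integrable (fun x => ∫ y, f y ∂κ x) ν := by
  rw [Measure.comp_eq_comp_const_apply] at hf
  exact hf.integral_comp

theorem integral_integral_bind {f : Ω → E} (hf : Integrable f (ν.bind κ)) :
    ∫ x, ∫ y, f y ∂κ x ∂ν = ∫ x, f x ∂ν.bind κ := by
  rw [Measure.comp_eq_comp_const_apply] at hf ⊢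
  rw [Kernel.integral_comp hf]
  simp

theorem aestronglyMeasurable_integral_bind [CompleteSpace E] {f : Ω → E} (hκ : Measurable[m] κ)
    (hf : AEStronglyMeasurable f (ν.bind κ)) :
    AEStronglyMeasurable[m] (fun x => ∫ y, f y ∂κ x) ν := by
  let κm : @Kernel Ω Ω m m0 := @Kernel.mk _ _ m m0 κ hκ
  refine ⟨fun x => ∫ y, hf.mk f y ∂κm x, hf.stronglyMeasurable_mk.integral_kernel, ?_⟩
  filter_upwards [Measure.ae_ae_of_ae_comp hf.ae_eq_mk] with x hx
  exact integral_congr_ae hx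

theorem integral_kernel_ae_eq_condExp [CompleteSpace E] (hm : m ≤ m0) [SigmaFinite (ν.trim hm)]
    (hκm : Measurable[m] κ) (hκ : κ.IsReversible ν)
    (hκY : ∀ Y, MeasurableSet[m] Y → (κ · Y) =ᵐ[ν] Y.indicator 1) {f : Ω → E}
    (hf : Integrable f ν) : (fun x => ∫ y, f y ∂κ x) =ᵐ[ν] ν[f | m] := by
  have hbind {Y : Set Ω} (hY : MeasurableSet[m] Y) : (ν.restrict Y).bind κ = ν.restrict Y :=
    bind_restrict_of_isReversible hκ (hm Y hY) (hκY Y hY)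
  have hinv : ν.bind κ = ν := by simpa using hbind MeasurableSet.univ
  refine ae_eq_condExp_of_forall_setIntegral_eq hm hf (fun _ _ _ => ?_) (fun Y hY _ => ?_) ?_
  · exact (integrable_integral_bind (by rwa [hinv])).integrableOn
  · rw [integral_integral_bind (by rw [hbind hY]; exact hf.integrableOn), hbind hY]
  · exact aestronglyMeasurable_integral_bind hκm (by rw [hinv]; exact hf.aestronglyMeasurable)

end KernelCondExp

section ClassMeans

open ProbabilityTheory

theorem relMean_eq_div {X : Type*} (w f : X → ℝ) (F : Setoid X) (x : X) :
    relMean w f F x = (∑ᶠ y ∈ {y | F x y}, f y * w y) / ∑ᶠ y ∈ {y | F x y}, w y := by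
  unfold relMean setMean weightOf
  split_ifs with h
  · rfl
  · rw [not_not.1 h, div_zero]

variable {X : Type*} [MeasurableSpace X] {E F : Setoid X} {μ : Measure X} {u : X → ENNReal}

/-- The total `u`-weight of the `F`-class of `x`. -/
def classWeight (u : X → ENNReal) (F : Setoid X) (x : X) : ENNReal := ∫⁻ y, u y ∂classMeasure F x

/-- The probability measure on the `F`-class of `x` proportional to `u`. It is the zero measure if
the class has weight zero or infinity, matching the convention of `setMean`. -/
def meanMeasure (u : X → ENNReal) (F : Setoid X) (x : X) : Measure X :=
  (classWeight u F x)⁻¹ • (classMeasure F x).withDensity u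

theorem classWeight_congr {x y : X} (h : F x y) : classWeight u F x = classWeight u F y := by
  rw [classWeight, classWeight, classMeasure_congr h]

theorem meanMeasure_congr {x y : X} (h : F x y) : meanMeasure u F x = meanMeasure u F y := by
  rw [meanMeasure, meanMeasure, classWeight_congr h, classMeasure_congr h]

theorem meanMeasure_apply {A : Set X} (hA : MeasurableSet A) (x : X) :
    meanMeasure u F x A = (classWeight u F x)⁻¹ * ∫⁻ y, A.indicator u y ∂classMeasure F x := by
  rw [meanMeasure, Measure.smul_apply, withDensity_apply _ hA, lintegral_indicator hA, smul_eq_mul]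

theorem IsFiniteBorel.classWeight_ne_zero [MeasurableSingletonClass X] (hF : IsFiniteBorel F)
    (hu : Measurable u) {x : X} (hx : u x ≠ 0) : classWeight u F x ≠ 0 := by
  rw [classWeight, Ne, lintegral_eq_zero_iff hu]
  exact fun h => hx ((hF.ae_classMeasure_iff.1 h) x (F.refl x))

theorem IsFiniteBorel.classWeight_ne_top [MeasurableSingletonClass X] (hF : IsFiniteBorel F)
    (hu : ∀ x, u x ≠ ⊤) (x : X) : classWeight u F x ≠ ⊤ := by
  rw [classWeight, classMeasure, ← (hF.finite_class x).coe_toFinset, lintegral_finset]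
  simp [ENNReal.sum_eq_top, hu]

theorem IsFiniteBorel.meanMeasure_apply_of_isInvariant [MeasurableSingletonClass X]
    (hF : IsFiniteBorel F) (hu : Measurable u) (hu_top : ∀ x, u x ≠ ⊤) {Y : Set X}
    (hY : MeasurableSet Y) (hYi : IsInvariant F Y) {x : X} (hx : u x ≠ 0) :
    meanMeasure u F x Y = Y.indicator 1 x := by
  have hclass : ∀ᵐ y ∂classMeasure F x, Y.indicator u y = Y.indicator 1 x * u y := by
    refine hF.ae_classMeasure_iff.2 fun y hxy => ?_
    by_cases hxY : x ∈ Y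
    · simp [hxY, hYi x y hxy hxY]
    · have hyY : y ∉ Y := fun hy => hxY (hYi y x (F.symm hxy) hy)
      simp [hxY, hyY]
  rw [meanMeasure_apply hY, lintegral_congr_ae hclass, lintegral_const_mul _ hu, ← classWeight,
    mul_left_comm, ENNReal.inv_mul_cancel (hF.classWeight_ne_zero hu hx)
      (hF.classWeight_ne_top hu_top x), mul_one]

theorem IsFiniteBorel.integral_classMeasure [MeasurableSingletonClass X] (hF : IsFiniteBorel F)
    (h : X → ℝ) (x : X) : ∫ y, h y ∂classMeasure F x = ∑ᶠ y ∈ {y | F x y}, h y := by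
  have hint : IntegrableOn h ((hF.finite_class x).toFinset : Set X) Measure.count := by
    rw [← Set.biUnion_of_singleton ((hF.finite_class x).toFinset : Set X)]
    exact (integrableOn_finset_iUnion).2 fun y _ => integrableOn_singleton (hx := by simp)
  rw [finsum_mem_eq_finite_toFinset_sum _ (hF.finite_class x), classMeasure]
  nth_rw 1 [← (hF.finite_class x).coe_toFinset]
  rw [setIntegral_finset _ hint]
  simp [Measure.real]

theorem IsFiniteBorel.integral_meanMeasure [MeasurableSingletonClass X] (hF : IsFiniteBorel F)
    {w : X → ℝ} (hw : Measurable w) (hw0 : ∀ x, 0 ≤ w x) (f : X → ℝ) (x : X) :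
    ∫ y, f y ∂meanMeasure (fun y => ENNReal.ofReal (w y)) F x = relMean w f F x := by
  have hweight : (classWeight (fun y => ENNReal.ofReal (w y)) F x).toReal =
      ∑ᶠ y ∈ {y | F x y}, w y := by
    rw [← hF.integral_classMeasure, integral_eq_lintegral_of_nonneg_ae (.of_forall hw0)
      hw.aestronglyMeasurable, classWeight]
  have hsum : ∫ y, f y ∂(classMeasure F x).withDensity (fun y => ENNReal.ofReal (w y)) =
      ∑ᶠ y ∈ {y | F x y}, f y * w y := by
    rw [← hF.integral_classMeasure, integral_withDensity_eq_integral_toReal_smul hw.ennreal_ofReal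
      (.of_forall fun _ => ENNReal.ofReal_lt_top)]
    simp only [ENNReal.toReal_ofReal (hw0 _), smul_eq_mul, mul_comm]
  rw [meanMeasure, integral_smul_measure, ENNReal.toReal_inv, hweight, hsum, relMean_eq_div,
    smul_eq_mul, inv_mul_eq_div]

variable [StandardBorelSpace X]

theorem IsFiniteBorel.measurable_classWeight (hF : IsFiniteBorel F) (hu : Measurable u) :
    Measurable (classWeight u F) :=
  (Measure.measurable_lintegral hu).comp hF.measurable_classMeasure

theorem IsFiniteBorel.measurable_meanMeasure (hF : IsFiniteBorel F) (hu : Measurable u) :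
    Measurable (meanMeasure u F) := by
  refine Measure.measurable_of_measurable_coe _ fun A hA => ?_
  simp only [meanMeasure_apply hA]
  exact (hF.measurable_classWeight hu).inv.mul (hF.measurable_classWeight (hu.indicator hA))

/-- `meanMeasure` as a kernel: integration against it averages over the `F`-classes. -/
def IsFiniteBorel.meanKernel (hF : IsFiniteBorel F) (hu : Measurable u) : Kernel X X where
  toFun := meanMeasure u F
  measurable' := hF.measurable_meanMeasure hu

theorem IsFiniteBorel.setLIntegral_meanMeasure (hF : IsFiniteBorel F) (hu : Measurable u)
    {A B : Set X} (hA : MeasurableSet A) (hB : MeasurableSet B) :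
    ∫⁻ x in A, meanMeasure u F x B ∂μ.withDensity u =
      ∫⁻ x, ∫⁻ y, (classWeight u F x)⁻¹ * A.indicator u x * B.indicator u y
        ∂classMeasure F x ∂μ := by
  have hmean : Measurable fun x => meanMeasure u F x B :=
    (Measure.measurable_coe hB).comp (hF.measurable_meanMeasure hu)
  rw [restrict_withDensity hA, lintegral_withDensity_eq_lintegral_mul _ hu hmean,
    ← lintegral_indicator hA]
  refine lintegral_congr fun x => ?_
  rw [lintegral_const_mul _ (hu.indicator hB)]
  by_cases hx : x ∈ A
  · simp only [Set.indicator_of_mem hx, Pi.mul_apply, meanMeasure_apply hB]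
    ring
  · simp [hx]

theorem IsFiniteBorel.isReversible_meanKernel (hF : IsFiniteBorel F) (hμ : PreservesMeasure E μ)
    (hFE : F ≤ E) (hu : Measurable u) :
    (hF.meanKernel hu).IsReversible (μ.withDensity u) := by
  intro A B hA hB
  have hmass : Measurable fun p : X × X =>
      (classWeight u F p.1)⁻¹ * A.indicator u p.1 * B.indicator u p.2 :=
    (((hF.measurable_classWeight hu).inv.mul (hu.indicator hA)).comp measurable_fst).mul
      ((hu.indicator hB).comp measurable_snd)
  calc ∫⁻ x in A, meanMeasure u F x B ∂μ.withDensity u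
      = ∫⁻ x, ∫⁻ y, (classWeight u F x)⁻¹ * A.indicator u x * B.indicator u y
          ∂classMeasure F x ∂μ := hF.setLIntegral_meanMeasure hu hA hB
    _ = ∫⁻ x, ∫⁻ y, (classWeight u F y)⁻¹ * A.indicator u y * B.indicator u x
          ∂classMeasure F x ∂μ := hF.lintegral_lintegral_classMeasure_swap hμ hFE hmass
    _ = ∫⁻ x, ∫⁻ y, (classWeight u F x)⁻¹ * B.indicator u x * A.indicator u y
          ∂classMeasure F x ∂μ := by
        refine lintegral_congr fun x => lintegral_congr_ae ?_
        refine hF.ae_classMeasure_iff.2 fun y hxy => ?_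
        rw [classWeight_congr hxy]
        ring
    _ = ∫⁻ x in B, meanMeasure u F x A ∂μ.withDensity u :=
        (hF.setLIntegral_meanMeasure hu hB hA).symm

end ClassMeans

section Convergence

variable {X : Type*} {E F : Setoid X} {w f : X → ℝ}

theorem relMean_congr {x y : X} (h : F x y) : relMean w f F x = relMean w f F y := by
  rw [relMean, relMean, setOf_rel_congr h]

/-- The union of the `E`-classes on which `w` does not vanish identically. Off this set all means
are `0`. -/
def weightSupport (E : Setoid X) (w : X → ℝ) : Set X := {x | ∃ y, E x y ∧ w y ≠ 0}

theorem weightSupport_mono (hFE : F ≤ E) : weightSupport F w ⊆ weightSupport E w :=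
  fun _ ⟨y, hxy, hy⟩ => ⟨y, hFE hxy, hy⟩

theorem relMean_eq_zero_of_notMem_weightSupport {x : X} (hx : x ∉ weightSupport F w) :
    relMean w f F x = 0 := by
  have hweight : weightOf w {y | F x y} = 0 :=
    finsum_mem_eq_zero_of_forall_eq_zero fun y hy => by_contra fun hwy => hx ⟨y, hy, hwy⟩
  rw [relMean, setMean, if_neg (not_not.2 hweight)]

variable [MeasurableSpace X] {μ : Measure X} {En : ℕ → Setoid X}

/-- The σ-algebra of `E`-invariant Borel sets. -/
@[reducible] def invariantSpace (E : Setoid X) : MeasurableSpace X where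
  MeasurableSet' s := MeasurableSet s ∧ IsInvariant E s
  measurableSet_empty := ⟨MeasurableSet.empty, fun _ _ _ h => h⟩
  measurableSet_compl s hs := ⟨hs.1.compl, fun x y hxy hx hy => hx (hs.2 y x (E.symm hxy) hy)⟩
  measurableSet_iUnion s hs := ⟨MeasurableSet.iUnion fun n => (hs n).1, fun x y hxy hx => by
    obtain ⟨n, hn⟩ := Set.mem_iUnion.1 hx
    exact Set.mem_iUnion.2 ⟨n, (hs n).2 x y hxy hn⟩⟩

theorem invariantSpace_le (E : Setoid X) : invariantSpace E ≤ ‹MeasurableSpace X› :=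
  fun _ hs => hs.1

theorem invariantSpace_antitone : Antitone (invariantSpace : Setoid X → MeasurableSpace X) :=
  fun _ _ hEF _ hs => ⟨hs.1, fun x y hxy => hs.2 x y (hEF hxy)⟩

theorem measurable_invariantSpace {β : Type*} [MeasurableSpace β] {h : X → β} (hm : Measurable h)
    (hinv : ∀ x y, E x y → h x = h y) : Measurable[invariantSpace E] h :=
  fun _ hs => ⟨hm hs, fun x y hxy hx => Set.mem_preimage.2 (hinv x y hxy ▸ hx)⟩

theorem eq_of_measurable_invariantSpace {β : Type*} [MeasurableSpace β]
    [MeasurableSingletonClass β] {h : X → β} (hm : Measurable[invariantSpace E] h) {x y : X}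
    (hxy : E x y) : h x = h y :=
  ((hm (measurableSet_singleton (h x))).2 x y hxy rfl).symm

theorem IsHyperfiniteWitness.le (h : IsHyperfiniteWitness E En) (n : ℕ) : En n ≤ E :=
  fun {x y} hxy => (h.exhausts x y).2 ⟨n, hxy⟩

theorem IsHyperfiniteWitness.iInf_invariantSpace (h : IsHyperfiniteWitness E En) :
    ⨅ n, invariantSpace (En n) = invariantSpace E := by
  refine le_antisymm (fun s hs => ?_) (le_iInf fun n => invariantSpace_antitone (h.le n))
  rw [MeasurableSpace.measurableSet_iInf] at hs
  refine ⟨(hs 0).1, fun x y hxy => ?_⟩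
  obtain ⟨n, hn⟩ := (h.exhausts x y).1 hxy
  exact (hs n).2 x y hn

theorem IsHyperfiniteWitness.eventually_relMean_congr (h : IsHyperfiniteWitness E En) {x y : X}
    (hxy : E x y) : ∀ᶠ n in atTop, relMean w f (En n) x = relMean w f (En n) y := by
  obtain ⟨n, hn⟩ := (h.exhausts x y).1 hxy
  filter_upwards [eventually_ge_atTop n] with k hk
  exact relMean_congr (h.monotone hk hn)

theorem isFiniteMeasure_weightedMeasure (hw : Integrable w μ) :
    IsFiniteMeasure (weightedMeasure μ w) :=
  isFiniteMeasure_withDensity_ofReal hw.2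

theorem indicator_weightSupport_ae_eq (hw : Measurable w) (g : X → ℝ) :
    (weightSupport E w).indicator g =ᵐ[weightedMeasure μ w] g := by
  rw [EventuallyEq, weightedMeasure, ae_withDensity_iff hw.ennreal_ofReal]
  refine .of_forall fun x hx => ?_
  have hxs : x ∈ weightSupport E w :=
    ⟨x, E.refl x, fun h0 => hx (by rw [h0, ENNReal.ofReal_zero])⟩
  exact Set.indicator_of_mem hxs g

variable [StandardBorelSpace X]

theorem IsFiniteBorel.relMean_ae_eq_condExp (hF : IsFiniteBorel F) (hμ : PreservesMeasure E μ)
    (hFE : F ≤ E) (hw : Measurable w) (hw0 : ∀ x, 0 ≤ w x) (hwi : Integrable w μ)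
    (hfi : Integrable f (weightedMeasure μ w)) :
    relMean w f F =ᵐ[weightedMeasure μ w] (weightedMeasure μ w)[f | invariantSpace F] := by
  have := isFiniteMeasure_weightedMeasure hwi
  have hrel : relMean w f F = fun x => ∫ y, f y ∂hF.meanKernel hw.ennreal_ofReal x :=
    funext fun x => (hF.integral_meanMeasure hw hw0 f x).symm
  rw [hrel]
  refine integral_kernel_ae_eq_condExp (ν := weightedMeasure μ w) (invariantSpace_le F)
    (measurable_invariantSpace (hF.measurable_meanMeasure hw.ennreal_ofReal)
      fun _ _ => meanMeasure_congr)
    (hF.isReversible_meanKernel hμ hFE hw.ennreal_ofReal) (fun Y hY => ?_) hfi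
  exact (ae_withDensity_iff hw.ennreal_ofReal).2 <| .of_forall fun _ =>
    hF.meanMeasure_apply_of_isInvariant hw.ennreal_ofReal (fun _ => ENNReal.ofReal_ne_top) hY.1 hY.2

theorem IsHyperfiniteWitness.ae_weightedMeasure_tendsto_relMean (h : IsHyperfiniteWitness E En)
    (hμ : PreservesMeasure E μ) (hw : Measurable w) (hw0 : ∀ x, 0 ≤ w x) (hwi : Integrable w μ)
    (hf : Integrable f (weightedMeasure μ w)) :
    ∀ᵐ x ∂weightedMeasure μ w, Tendsto (fun n => relMean w f (En n) x) atTop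
      (𝓝 ((weightedMeasure μ w)[f | invariantSpace E] x)) := by
  have := isFiniteMeasure_weightedMeasure hwi
  have hlevy := ae_tendsto_condExp_iInf (fun i j hij => invariantSpace_antitone (h.monotone hij))
    (fun n => invariantSpace_le (En n)) hf
  rw [h.iInf_invariantSpace] at hlevy
  filter_upwards [hlevy, ae_all_iff.2 fun n =>
    (h.isFiniteBorel n).relMean_ae_eq_condExp hμ (h.le n) hw hw0 hwi hf] with x hx hxn
  simpa only [hxn] using hx

theorem IsHyperfiniteWitness.ae_forall_class (h : IsHyperfiniteWitness E En)
    (hμ : PreservesMeasure E μ) {p : X → Prop} (hp : ∀ᵐ x ∂μ, p x) :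
    ∀ᵐ x ∂μ, ∀ y, E x y → p y := by
  filter_upwards [ae_all_iff.2 fun n => (h.isFiniteBorel n).ae_forall_class hμ (h.le n) hp]
    with x hx y hxy
  obtain ⟨n, hn⟩ := (h.exhausts x y).1 hxy
  exact hx n y hn

theorem IsHyperfiniteWitness.ae_tendsto_relMean (h : IsHyperfiniteWitness E En)
    (hμ : PreservesMeasure E μ) (hw : Measurable w) (hw0 : ∀ x, 0 ≤ w x) (hwi : Integrable w μ)
    (hf : Integrable f (weightedMeasure μ w)) :
    ∀ᵐ x ∂μ, Tendsto (fun n => relMean w f (En n) x) atTop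
      (𝓝 ((weightSupport E w).indicator ((weightedMeasure μ w)[f | invariantSpace E]) x)) := by
  have hconv := h.ae_weightedMeasure_tendsto_relMean hμ hw hw0 hwi hf
  rw [weightedMeasure, ae_withDensity_iff hw.ennreal_ofReal] at hconv
  filter_upwards [h.ae_forall_class hμ hconv] with x hx
  by_cases hxs : x ∈ weightSupport E w
  · rw [Set.indicator_of_mem hxs]
    obtain ⟨y, hxy, hy⟩ := hxs
    rw [eq_of_measurable_invariantSpace stronglyMeasurable_condExp.measurable hxy]
    have hwy : ENNReal.ofReal (w y) ≠ 0 := (ENNReal.ofReal_pos.2 ((hw0 y).lt_of_ne' hy)).ne'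
    exact (hx y hxy hwy).congr' ((h.eventually_relMean_congr hxy).mono fun _ => Eq.symm)
  · rw [Set.indicator_of_notMem hxs]
    refine tendsto_const_nhds.congr fun n => Eq.symm ?_
    exact relMean_eq_zero_of_notMem_weightSupport (mt (weightSupport_mono (h.le n) ·) hxs)

end Convergence

end HyperfiniteMeans

end

theorem mainTheorem9 {X : Type*} [MeasurableSpace X] [StandardBorelSpace X]
    (μ : Measure X) (E : Setoid X)
    (hE : HyperfiniteMeans.IsHyperfinite E)
    (hμ : HyperfiniteMeans.PreservesMeasure E μ)
    (w : X → ℝ) (hw_meas : Measurable w) (hw_nonneg : ∀ x, 0 ≤ w x) (hw_int : Integrable w μ)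
    (f : X → ℝ) (hf : Integrable f (HyperfiniteMeans.weightedMeasure μ w)) :
    ∃ g : X → ℝ,
      (∀ En : ℕ → Setoid X, HyperfiniteMeans.IsHyperfiniteWitness E En →
        ∀ᵐ x ∂μ, Tendsto (fun n => HyperfiniteMeans.relMean w f (En n) x) atTop (𝓝 (g x))) ∧
      Integrable g (HyperfiniteMeans.weightedMeasure μ w) ∧
      (∀ Y : Set X, MeasurableSet Y → HyperfiniteMeans.IsInvariant E Y →
        ∫ x in Y, g x ∂(HyperfiniteMeans.weightedMeasure μ w) =
          ∫ x in Y, f x ∂(HyperfiniteMeans.weightedMeasure μ w)) ∧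
      eLpNorm g 1 (HyperfiniteMeans.weightedMeasure μ w) ≤
        eLpNorm f 1 (HyperfiniteMeans.weightedMeasure μ w) := by
  have := HyperfiniteMeans.isFiniteMeasure_weightedMeasure hw_int
  set ν := HyperfiniteMeans.weightedMeasure μ w
  have hae : (HyperfiniteMeans.weightSupport E w).indicator
      (ν[f | HyperfiniteMeans.invariantSpace E]) =ᵐ[ν] ν[f | HyperfiniteMeans.invariantSpace E] :=
    HyperfiniteMeans.indicator_weightSupport_ae_eq hw_meas _
  refine ⟨(HyperfiniteMeans.weightSupport E w).indicator
    (ν[f | HyperfiniteMeans.invariantSpace E]), fun En hEn => ?_, ?_, fun Y hY hYi => ?_, ?_⟩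
  · exact hEn.ae_tendsto_relMean hμ hw_meas hw_nonneg hw_int hf
  · exact integrable_condExp.congr hae.symm
  · rw [integral_congr_ae (ae_restrict_of_ae hae)]
    exact setIntegral_condExp (HyperfiniteMeans.invariantSpace_le E) hf ⟨hY, hYi⟩
  · rw [eLpNorm_congr_ae hae]
    exact eLpNorm_condExp_le_eLpNorm f le_rfl
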